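/- Let $n\in\mathbb{N}$ and let $\|\cdot\|$ be an absolute norm on $\mathbb{R}^n$, i.e. a norm with $\|(a_1,\dots,a_n)\|=\|(|a_1|,\dots,|a_n|)\|$ for all real $a_1,\dots,a_n$ and $\|e_1\|=\dots=\|e_n\|=1$ for the canonical basis. Let $X=(\mathbb{R}^n,\|\cdot\|)$, with closed unit ball $B_X$ and unit sphere $S_X$, and suppose that $X$ is a CL-space, i.e. $B_X$ is the absolutely convex hull of every maximal convex subset of $S_X$. Let $a=(a_1,\dots,a_n)\in\mathbb{R}^n$ be such that $x=(|a_1|,\dots,|a_n|)\in S_X$. Then $x$ is a point of upper monotonicity of $X$ (that is, $\|x+y\|>1$ for every nonzero $y\in\mathbb{R}^n$ with nonnegative coordinates) if and only if $x$ is a convex combination of extreme points of $B_X$ all of whose coordinates are nonnegative. -/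

import Mathlib

/-- A norm on `ℝⁿ` (a seminorm vanishing only at `0`) is absolute if it depends only on the moduli
of the coordinates and every canonical basis vector has norm one. -/
structure IsAbsoluteNorm {n : ℕ} (N : Seminorm ℝ (Fin n → ℝ)) : Prop where
  eq_zero_of_map_eq_zero : ∀ x : Fin n → ℝ, N x = 0 → x = 0
  map_abs : ∀ x : Fin n → ℝ, N (fun i => |x i|) = N x
  map_single : ∀ i : Fin n, N (Pi.single i 1) = 1

/-- The space `(E, N)` is a CL-space if its closed unit ball is the absolutely convex hull of every
maximal convex subset of its unit sphere. -/
def IsCLSpace {E : Type*} [AddCommGroup E] [Module ℝ E] (N : Seminorm ℝ E) : Prop :=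
  ∀ M : Set E, Maximal (fun C : Set E => C ⊆ {x | N x = 1} ∧ Convex ℝ C) M →
    absConvexHull ℝ M = N.closedBall 0 1

/-- A nonnegative norm-one element `x` is a point of upper monotonicity if adding any nonzero
nonnegative `y` strictly increases its norm (the order on `Fin n → ℝ` is coordinatewise). -/
def IsUpperMonotonicityPoint {n : ℕ} (N : Seminorm ℝ (Fin n → ℝ)) (x : Fin n → ℝ) : Prop :=
  0 ≤ x ∧ N x = 1 ∧ ∀ y : Fin n → ℝ, 0 ≤ y → y ≠ 0 → 1 < N (x + y)

/-! In a CL-space each unit vector is normed by a functional equal to 1 or -1 at every extreme point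
(`IsCLSpace.exists_dual`). For the j-th basis vector, sign changes turn it into a positive
functional g ≤ N that is 1 at all nonnegative extreme points, with g z ≥ z j for z ≥ 0
(`exists_nonneg_dual`). So if x lies in their hull, N (x + y) ≥ g (x + y) ≥ 1 + y j. Conversely,
some w in that hull dominates x (`exists_abs_le_convexHull`); since N w ≤ 1, upper monotonicity
forces w = x. -/

/-- Every convex subset of the unit sphere of a seminorm extends to a maximal one. -/
theorem Seminorm.exists_maximal_convex_subset_sphere {E : Type*} [AddCommGroup E] [Module ℝ E]
    (N : Seminorm ℝ E) {C : Set E} (hC : C ⊆ {x | N x = 1}) (hconv : Convex ℝ C) :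
    ∃ M, C ⊆ M ∧ Maximal (fun C : Set E => C ⊆ {x | N x = 1} ∧ Convex ℝ C) M := by
  refine zorn_subset_nonempty {C : Set E | C ⊆ {x | N x = 1} ∧ Convex ℝ C} ?_ C ⟨hC, hconv⟩
  intro c hc hchain _
  exact ⟨⋃₀ c, ⟨Set.sUnion_subset fun s hs => (hc hs).1,
    hchain.directedOn.convex_sUnion fun s hs => (hc hs).2⟩, fun s => Set.subset_sUnion_of_mem⟩

/-- A convex subset of the unit sphere of a continuous seminorm lies in a supporting
hyperplane of the unit ball. -/
theorem Seminorm.exists_dual_eq_one {E : Type*} [AddCommGroup E] [Module ℝ E]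
    [TopologicalSpace E] [IsTopologicalAddGroup E] [ContinuousSMul ℝ E]
    {N : Seminorm ℝ E} (hcont : Continuous N) {C : Set E}
    (hC : C ⊆ {x | N x = 1}) (hconv : Convex ℝ C) :
    ∃ f : E →ₗ[ℝ] ℝ, (∀ x, f x ≤ N x) ∧ ∀ x ∈ C, f x = 1 := by
  have hopen : IsOpen (N.ball 0 1) := by
    rw [N.ball_zero_eq]
    exact isOpen_lt hcont continuous_const
  have hdisj : Disjoint (N.ball 0 1) C := by
    rw [Set.disjoint_left]
    intro x hx hxC
    rw [N.mem_ball_zero, hC hxC] at hx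
    exact lt_irrefl _ hx
  obtain ⟨f, u, hfu, huf⟩ := geometric_hahn_banach_open (N.convex_ball 0 1) hopen hconv hdisj
  have hu : 0 < u := by simpa using hfu 0 (by simp [N.mem_ball_zero])
  have hle : ∀ x, f x ≤ u * N x := by
    intro x
    -- Scaling by N x + ε / u rather than N x also covers N x = 0.
    refine le_of_forall_pos_lt_add fun ε hε => ?_
    have hr : 0 < N x + ε / u := by positivity
    have hmem : (N x + ε / u)⁻¹ • x ∈ N.ball 0 1 := by
      rw [N.mem_ball_zero, map_smul_eq_mul, Real.norm_of_nonneg (by positivity),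
        inv_mul_lt_one₀ hr]
      have : 0 < ε / u := by positivity
      linarith
    have h := hfu _ hmem
    rw [map_smul, smul_eq_mul, inv_mul_lt_iff₀ hr, add_mul, div_mul_cancel₀ _ hu.ne'] at h
    linarith
  refine ⟨u⁻¹ • (f : E →ₗ[ℝ] ℝ), fun x => ?_, fun x hx => ?_⟩
  · simpa [inv_mul_le_iff₀ hu] using hle x
  · have h1 : f x = u := le_antisymm (by simpa [show N x = 1 from hC hx] using hle x) (huf x hx)
    simp [h1, hu.ne']

theorem Seminorm.continuous_of_finiteDimensional {E : Type*} [NormedAddCommGroup E]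
    [NormedSpace ℝ E] [FiniteDimensional ℝ E] (N : Seminorm ℝ E) : Continuous N :=
  continuousOn_univ.1 (N.convexOn.continuousOn isOpen_univ)

/-- In a CL-space, every norm-one vector is normed by a functional of norm at most one taking only
the values `1` and `-1` at the extreme points of the unit ball. -/
theorem IsCLSpace.exists_dual {E : Type*} [AddCommGroup E] [Module ℝ E]
    [TopologicalSpace E] [IsTopologicalAddGroup E] [ContinuousSMul ℝ E]
    {N : Seminorm ℝ E} (hCL : IsCLSpace N) (hcont : Continuous N) {x : E} (hx : N x = 1) :
    ∃ f : E →ₗ[ℝ] ℝ, (∀ z, f z ≤ N z) ∧ f x = 1 ∧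
      ∀ e ∈ (N.closedBall 0 1).extremePoints ℝ, f e = 1 ∨ f e = -1 := by
  obtain ⟨M, hxM, hM⟩ := N.exists_maximal_convex_subset_sphere
    (Set.singleton_subset_iff.2 hx) (convex_singleton x)
  rw [Set.singleton_subset_iff] at hxM
  obtain ⟨f, hf, hfM⟩ := Seminorm.exists_dual_eq_one hcont hM.prop.1 hM.prop.2
  refine ⟨f, hf, hfM x hxM, fun e he => ?_⟩
  -- The ball is the convex hull of M ∪ -M, so its extreme points lie in M ∪ -M.
  rw [← hCL M hM, ← convexHull_union_neg_eq_absConvexHull] at he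
  rcases extremePoints_convexHull_subset he with h | h
  · exact Or.inl (hfM e h)
  · exact Or.inr (by simpa [neg_eq_iff_eq_neg] using hfM _ h)

namespace IsAbsoluteNorm

variable {n : ℕ} {N : Seminorm ℝ (Fin n → ℝ)}

theorem map_mul (hN : IsAbsoluteNorm N) {s : Fin n → ℝ} (hs : ∀ i, |s i| = 1) (x : Fin n → ℝ) :
    N (s * x) = N x := by
  rw [← hN.map_abs, ← hN.map_abs x]
  simp [abs_mul, hs]

/-- Flipping the sign of coordinate i preserves N and moves x by 2 * x i along the i-th axis; the
triangle inequality concludes. -/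
theorem abs_apply_le (hN : IsAbsoluteNorm N) (x : Fin n → ℝ) (i : Fin n) : |x i| ≤ N x := by
  have hs : ∀ j, |Function.update (1 : Fin n → ℝ) i (-1) j| = 1 := by
    intro j
    rcases eq_or_ne j i with rfl | h <;> simp [*]
  have hd : x - Function.update (1 : Fin n → ℝ) i (-1) * x = (2 * x i) • Pi.single i 1 := by
    ext j
    rcases eq_or_ne j i with rfl | h
    · simp; ring
    · simp [h]
  have h := map_sub_le_add N x (Function.update (1 : Fin n → ℝ) i (-1) * x)
  rw [hd, hN.map_mul hs, map_smul_eq_mul, hN.map_single, Real.norm_eq_abs, abs_mul] at h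
  norm_num at h
  linarith

theorem isCompact_closedBall (hN : IsAbsoluteNorm N) : IsCompact (N.closedBall 0 1) := by
  refine Metric.isCompact_of_isClosed_isBounded ?_ ?_
  · rw [N.closedBall_zero_eq]
    exact isClosed_le N.continuous_of_finiteDimensional continuous_const
  · refine (Metric.isBounded_closedBall (x := (0 : Fin n → ℝ)) (r := 1)).subset fun x hx => ?_
    rw [N.mem_closedBall_zero] at hx
    rw [mem_closedBall_zero_iff, pi_norm_le_iff_of_nonneg zero_le_one]
    exact fun i => (hN.abs_apply_le x i).trans hx

theorem mul_mem_extremePoints (hN : IsAbsoluteNorm N) {s : Fin n → ℝ} (hs : ∀ i, |s i| = 1)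
    {e : Fin n → ℝ} (he : e ∈ (N.closedBall 0 1).extremePoints ℝ) :
    s * e ∈ (N.closedBall 0 1).extremePoints ℝ := by
  have hss : s * s = 1 := by
    ext i
    simp [← abs_mul_abs_self (s i), hs]
  have hmem : ∀ x ∈ N.closedBall 0 1, s * x ∈ N.closedBall 0 1 := by
    intro x hx
    rwa [N.mem_closedBall_zero, hN.map_mul hs, ← N.mem_closedBall_zero]
  refine ⟨hmem e he.1, fun u hu v hv huv => ?_⟩
  obtain ⟨a, b, ha, hb, hab, h⟩ := huv
  have key := he.2 (hmem u hu) (hmem v hv) ⟨a, b, ha, hb, hab, by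
    rw [← mul_smul_comm, ← mul_smul_comm, ← mul_add, h, ← mul_assoc, hss, one_mul]⟩
  rw [← key, ← mul_assoc, hss, one_mul]

theorem abs_mem_extremePoints (hN : IsAbsoluteNorm N) {e : Fin n → ℝ}
    (he : e ∈ (N.closedBall 0 1).extremePoints ℝ) :
    (fun i => |e i|) ∈ (N.closedBall 0 1).extremePoints ℝ := by
  have hs : ∀ i, |if 0 ≤ e i then (1 : ℝ) else -1| = 1 := by
    intro i
    split_ifs <;> simp
  convert hN.mul_mem_extremePoints hs he using 1
  ext i
  by_cases h : 0 ≤ e i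
  · simp [h, abs_of_nonneg]
  · simp [h, abs_of_neg (not_le.1 h)]

/-- For an absolute CL-norm, each coordinate is dominated by a positive functional of norm at most
one which takes the value `1` at all nonnegative extreme points of the unit ball. -/
theorem exists_nonneg_dual (hN : IsAbsoluteNorm N) (hCL : IsCLSpace N) (j : Fin n) :
    ∃ g : (Fin n → ℝ) →ₗ[ℝ] ℝ, (∀ z, g z ≤ N z) ∧ (∀ z, 0 ≤ z → z j ≤ g z) ∧
      ∀ e ∈ (N.closedBall 0 1).extremePoints ℝ, 0 ≤ e → g e = 1 := by
  obtain ⟨f, hf, hfj, hfe⟩ := hCL.exists_dual N.continuous_of_finiteDimensional (hN.map_single j)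
  -- These signs make every coefficient of z ↦ f (s * z) nonnegative; the j-th is 1.
  set s : Fin n → ℝ := fun i => if 0 ≤ f (Pi.single i 1) then 1 else -1 with hs_def
  have hs : ∀ i, |s i| = 1 := by
    intro i
    simp only [hs_def]
    split_ifs <;> simp
  have hg : ∀ z, f (s * z) = ∑ i, z i * |f (Pi.single i 1)| := by
    intro z
    rw [f.pi_apply_eq_sum_univ]
    refine Finset.sum_congr rfl fun i _ => ?_
    have hsf : s i * f (Pi.single i 1) = |f (Pi.single i 1)| := by
      simp only [hs_def]
      split_ifs with h
      · simp [abs_of_nonneg h]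
      · simp [abs_of_neg (not_le.1 h)]
    have hsingle : (fun k => if i = k then (1 : ℝ) else 0) = Pi.single i 1 := by
      ext k
      simp [Pi.single_apply, eq_comm]
    rw [hsingle, ← hsf, Pi.mul_apply, smul_eq_mul]
    ring
  have hle : ∀ z, 0 ≤ z → z j ≤ f (s * z) := by
    intro z hz
    rw [hg]
    have h := Finset.single_le_sum (f := fun i => z i * |f (Pi.single i 1)|)
      (fun i _ => mul_nonneg (hz i) (abs_nonneg _)) (Finset.mem_univ j)
    simpa [hfj] using h
  refine ⟨f ∘ₗ LinearMap.mulLeft ℝ s, fun z => ?_, fun z hz => hle z hz, fun e he h0 => ?_⟩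
  · exact (hf _).trans_eq (hN.map_mul hs z)
  · rcases hfe _ (hN.mul_mem_extremePoints hs he) with h | h
    · exact h
    -- The value -1 is impossible: 0 ≤ e j ≤ f (s * e).
    · have h1 := (h0 j).trans (hle e h0)
      rw [h] at h1
      norm_num at h1

/-- The extreme points of the unit ball of an absolute CL-norm have coordinates `-1`, `0`, `1`. -/
theorem finite_extremePoints (hN : IsAbsoluteNorm N) (hCL : IsCLSpace N) :
    ((N.closedBall 0 1).extremePoints ℝ).Finite := by
  refine (Set.Finite.pi' fun _ : Fin n => Set.toFinite ({-1, 0, 1} : Set ℝ)).subset ?_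
  intro e he j
  obtain ⟨f, -, hfj, hfe⟩ := hCL.exists_dual N.continuous_of_finiteDimensional (hN.map_single j)
  have hs : ∀ i, |Function.update (1 : Fin n → ℝ) j (-1) i| = 1 := by
    intro i
    rcases eq_or_ne i j with rfl | h <;> simp [*]
  have hd : e - Function.update (1 : Fin n → ℝ) j (-1) * e = (2 * e j) • Pi.single j 1 := by
    ext i
    rcases eq_or_ne i j with rfl | h
    · simp; ring
    · simp [h]
  have h := congrArg f hd
  rw [map_sub, map_smul, hfj, smul_eq_mul, mul_one] at h
  simp only [Set.mem_insert_iff, Set.mem_singleton_iff]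
  -- Now 2 * e j is a difference of two numbers from {1, -1}.
  rcases hfe _ he with h1 | h1 <;> rcases hfe _ (hN.mul_mem_extremePoints hs he) with h2 | h2 <;>
    rw [h1, h2] at h
  · exact Or.inr (Or.inl (by linarith))
  · exact Or.inr (Or.inr (by linarith))
  · exact Or.inl (by linarith)
  · exact Or.inr (Or.inl (by linarith))

/-- Every vector of the unit ball of an absolute CL-norm is dominated in modulus by a convex
combination of nonnegative extreme points. -/
theorem exists_abs_le_convexHull (hN : IsAbsoluteNorm N) (hCL : IsCLSpace N) {z : Fin n → ℝ}
    (hz : z ∈ N.closedBall 0 1) :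
    ∃ w ∈ convexHull ℝ {y : Fin n → ℝ | y ∈ (N.closedBall 0 1).extremePoints ℝ ∧ ∀ i, 0 ≤ y i},
      ∀ i, |z i| ≤ w i := by
  set K := convexHull ℝ
    {y : Fin n → ℝ | y ∈ (N.closedBall 0 1).extremePoints ℝ ∧ ∀ i, 0 ≤ y i} with hK
  have hconv : Convex ℝ {z : Fin n → ℝ | ∃ w ∈ K, ∀ i, |z i| ≤ w i} := by
    rintro u ⟨u', hu', hu⟩ v ⟨v', hv', hv⟩ a b ha hb hab
    refine ⟨a • u' + b • v', convex_convexHull ℝ _ hu' hv' ha hb hab, fun i => ?_⟩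
    simp only [Pi.add_apply, Pi.smul_apply, smul_eq_mul]
    calc |a * u i + b * v i| ≤ |a * u i| + |b * v i| := abs_add_le _ _
      _ = a * |u i| + b * |v i| := by rw [abs_mul, abs_mul, abs_of_nonneg ha, abs_of_nonneg hb]
      _ ≤ a * u' i + b * v' i := by gcongr <;> simp [hu, hv]
  -- Krein–Milman; finitely many extreme points make the closure superfluous.
  have hball : convexHull ℝ ((N.closedBall 0 1).extremePoints ℝ) = N.closedBall 0 1 := by
    rw [← ((hN.finite_extremePoints hCL).isClosed_convexHull ℝ).closure_eq]
    exact closure_convexHull_extremePoints hN.isCompact_closedBall (N.convex_closedBall 0 1)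
  rw [← hball] at hz
  refine convexHull_min (fun e he => ?_) hconv hz
  exact ⟨fun i => |e i|, subset_convexHull ℝ _ ⟨hN.abs_mem_extremePoints he, fun _ => abs_nonneg _⟩,
    fun i => le_rfl⟩

end IsAbsoluteNorm

theorem mainTheorem11 (n : ℕ) (N : Seminorm ℝ (Fin n → ℝ)) (hN : IsAbsoluteNorm N)
    (hCL : IsCLSpace N) (a : Fin n → ℝ) (ha : N (fun i => |a i|) = 1) :
    IsUpperMonotonicityPoint N (fun i => |a i|) ↔
      (fun i => |a i|) ∈ convexHull ℝ
        {y : Fin n → ℝ | y ∈ (N.closedBall 0 1).extremePoints ℝ ∧ ∀ i, 0 ≤ y i} := by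
  constructor
  · rintro ⟨-, -, hmono⟩
    obtain ⟨w, hw, hle⟩ := hN.exists_abs_le_convexHull hCL (N.mem_closedBall_zero.2 ha.le)
    simp only [abs_abs] at hle
    have hNw : N w ≤ 1 := N.mem_closedBall_zero.1
      (convexHull_min (fun y hy => hy.1.1) (N.convex_closedBall 0 1) hw)
    by_cases h : w - (fun i => |a i|) = 0
    · rwa [← sub_eq_zero.1 h]
    · have h1 := hmono _ (sub_nonneg.2 hle) h
      rw [add_sub_cancel] at h1
      exact absurd hNw h1.not_ge
  · intro hx
    refine ⟨fun i => abs_nonneg _, ha, fun y hy hy0 => ?_⟩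
    obtain ⟨j, hj⟩ := Function.ne_iff.1 hy0
    have hyj : 0 < y j := lt_of_le_of_ne (hy j) (Ne.symm hj)
    obtain ⟨g, hgN, hgj, hge⟩ := hN.exists_nonneg_dual hCL j
    have hgx : g (fun i => |a i|) = 1 :=
      convexHull_min (t := {z | g z = 1}) (fun e he => hge e he.1 he.2)
        (convex_hyperplane g.isLinear 1) hx
    have h := hgN ((fun i => |a i|) + y)
    rw [map_add, hgx] at h
    linarith [hgj y hy]
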